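/- Let $S^1=\mathbf R/\mathbf Z$ with its usual distance and, for $N\ge 1$, let $E_N=\{i/N \bmod 1 : 1\le i\le N\}$ and let $P_N:S^1\to E_N$ be a nearest-point projection (ties being broken arbitrarily). For a map $f:S^1\to S^1$ let $f_N=P_N\circ f|_{E_N}:E_N\to E_N$ be its discretization, and for $x\in S^1$ let $\mu_x^{f_N}$ be the weak limit, as $M\to\infty$, of the probability measures $\frac1M\sum_{m=0}^{M-1}\delta_{f_N^m(P_N(x))}$ (that is, the uniform measure on the periodic orbit of $f_N$ into which the $f_N$-orbit of $P_N(x)$ eventually falls). For an integer $d$ let $\mathcal E^1_d(S^1)$ be the space of $C^1$ maps $f:S^1\to S^1$ of degree $d$ that are expanding (there is $\lambda>1$ with $|f'(x)|\ge\lambda$ for all $x$), endowed with the $C^1$ topology. Then for a generic $f\in\mathcal E^1_d(S^1)$ (i.e. for all $f$ in a residual subset), for every $f$-invariant Borel probability measure $\mu$, for a generic point $x\in S^1$ (i.e. for all $x$ in a residual subset of $S^1$, which may depend on $f$ and $\mu$), there is a strictly increasing sequence of integers $(N_k)_k$ such that $$\mu_x^{f_{N_k}}\longrightarrow\mu\quad\text{weakly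 as } k\to\infty.$$ -/

import Mathlib

open MeasureTheory Filter Topology

noncomputable section

/-- A `C^1` expanding map of degree `d` of the circle `ℝ/ℤ`: a continuous self-map `toMap` together
with its (continuous) derivative `derivMap`. That `toMap` is `C^1` with derivative `derivMap` and
has degree `d` is expressed by a lift `F : ℝ → ℝ`; expansion means `|f'| ≥ lam` for a `lam > 1`.
The derivative is determined by `toMap`, see `ExpandingCircleMap.toMap_injective`. -/
structure ExpandingCircleMap (d : ℤ) where
  /-- the map -/
  toMap : C(UnitAddCircle, UnitAddCircle)
  /-- its derivative -/
  derivMap : C(UnitAddCircle, ℝ)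
  exists_lift : ∃ F : ℝ → ℝ,
    (∀ t : ℝ, ((F t : ℝ) : UnitAddCircle) = toMap (t : UnitAddCircle)) ∧
    (∀ t : ℝ, F (t + 1) = F t + d) ∧
    (∀ t : ℝ, HasDerivAt F (derivMap (t : UnitAddCircle)) t)
  expanding : ∃ lam : ℝ, 1 < lam ∧ ∀ x : UnitAddCircle, lam ≤ |derivMap x|

namespace ExpandingCircleMap

variable {d : ℤ}

instance : CoeFun (ExpandingCircleMap d) (fun _ => UnitAddCircle → UnitAddCircle) :=
  ⟨fun f => f.toMap⟩

/-- The `C^1` topology: uniform convergence of the maps and of their derivatives (the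
compact-open topology on continuous maps from the compact circle to a metric space is the
topology of uniform convergence). -/
instance : TopologicalSpace (ExpandingCircleMap d) :=
  TopologicalSpace.induced (fun f => (f.toMap, f.derivMap)) inferInstance

/-- An expanding map is determined by its underlying map of the circle. -/
theorem toMap_injective :
    Function.Injective (toMap : ExpandingCircleMap d → C(UnitAddCircle, UnitAddCircle)) := by
  intro f g h
  obtain ⟨F, hF, -, hF'⟩ := f.exists_lift
  obtain ⟨G, hG, -, hG'⟩ := g.exists_lift
  have key : f.derivMap = g.derivMap := by
    ext x
    obtain ⟨t, rfl⟩ := QuotientAddGroup.mk_surjective x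
    have hcF : Continuous F := continuous_iff_continuousAt.2 fun t => (hF' t).continuousAt
    have hcG : Continuous G := continuous_iff_continuousAt.2 fun t => (hG' t).continuousAt
    have hint : ∀ s, ∃ n : ℤ, F s - G s = n := by
      intro s
      have h1 : ((F s : ℝ) : UnitAddCircle) = ((G s : ℝ) : UnitAddCircle) := by
        rw [hF, hG, h]
      have h2 : ((F s - G s : ℝ) : UnitAddCircle) = 0 := by
        rw [AddCircle.coe_sub, h1, sub_self]
      obtain ⟨n, hn⟩ := (AddCircle.coe_eq_zero_iff (1 : ℝ)).1 h2
      exact ⟨n, by simpa using hn.symm⟩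
    have hev : ∀ᶠ s in 𝓝 t, |(F s - G s) - (F t - G t)| < 1 := by
      have : ContinuousAt (fun s => F s - G s) t := (hcF.sub hcG).continuousAt
      have := Metric.tendsto_nhds.1 this 1 one_pos
      simpa only [Real.dist_eq] using this
    have hEq : (fun s => F s - G s) =ᶠ[𝓝 t] fun _ => F t - G t := by
      filter_upwards [hev] with s hs
      obtain ⟨n, hn⟩ := hint s
      obtain ⟨m, hm⟩ := hint t
      rw [hn, hm] at hs ⊢
      have : |n - m| < 1 := by exact_mod_cast hs
      have : n = m := by rw [abs_lt] at this; omega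
      rw [this]
    have h0 : HasDerivAt (fun s => F s - G s) 0 t :=
      (hasDerivAt_const t (F t - G t)).congr_of_eventuallyEq hEq
    have h1 := ((hF' t).sub (hG' t)).unique h0
    exact sub_eq_zero.1 h1
  cases f; cases g
  simp only at h key
  subst h; subst key
  rfl

end ExpandingCircleMap

/-- The uniform grid `E_N = {i/N mod 1 : 1 ≤ i ≤ N}` on the circle. -/
def circleGrid (N : ℕ+) : Set UnitAddCircle :=
  {x | ∃ i : ℕ, 1 ≤ i ∧ i ≤ (N : ℕ) ∧ x = (((i : ℝ) / (N : ℕ) : ℝ) : UnitAddCircle)}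

/-- `P` sends every point of the circle to (one of) the point(s) of the grid closest to it. -/
def IsNearestPointProjection (N : ℕ+) (P : UnitAddCircle → circleGrid N) : Prop :=
  ∀ x : UnitAddCircle, ∀ y ∈ circleGrid N, dist x (P x : UnitAddCircle) ≤ dist x y

/-- The discretization `f_N = P_N ∘ f|_{E_N} : E_N → E_N`. -/
def discretization (f : UnitAddCircle → UnitAddCircle) {N : ℕ+}
    (P : UnitAddCircle → circleGrid N) : circleGrid N → circleGrid N :=
  fun y => P (f y)

/-- The uniform probability measure `(1/(M+1)) ∑_{m=0}^{M} δ_{u m}` on the first `M + 1` terms of a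
sequence. -/
def averageDirac {X : Type*} [MeasurableSpace X] (u : ℕ → X) (M : ℕ) : ProbabilityMeasure X :=
  ⟨((M + 1 : ℕ) : ENNReal)⁻¹ • ∑ m ∈ Finset.range (M + 1), Measure.dirac (u m), ⟨by
    simp only [Measure.smul_apply, Measure.finsetSum_apply, measure_univ, Finset.sum_const,
      Finset.card_range, smul_eq_mul, nsmul_eq_mul, mul_one]
    exact ENNReal.inv_mul_cancel (by simp) (ENNReal.natCast_ne_top _)⟩⟩

/-- The Birkhoff averages of the Dirac masses along the `f_N`-orbit of `x_N = P_N x`. -/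
def discreteBirkhoffAverage (f : UnitAddCircle → UnitAddCircle) {N : ℕ+}
    (P : UnitAddCircle → circleGrid N) (x : UnitAddCircle) :
    ℕ → ProbabilityMeasure UnitAddCircle :=
  averageDirac fun m => (((discretization f P)^[m] (P x) : circleGrid N) : UnitAddCircle)

/-- The measure `μ_x^{f_N}`: the weak limit of the Birkhoff averages along the `f_N`-orbit of
`x_N = P_N x`. -/
def discreteLimitMeasure (f : UnitAddCircle → UnitAddCircle) {N : ℕ+}
    (P : UnitAddCircle → circleGrid N) (x : UnitAddCircle) : ProbabilityMeasure UnitAddCircle :=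
  limUnder atTop (discreteBirkhoffAverage f P x)

end

/-! The proof is a Baire argument on the maps, followed by one on the points. Fix an open arc `U`, a
precision `ε` and a rank `n₀`. It suffices that a dense set of maps has neighbourhoods on which
every invariant measure is `ε`-close, tested on 1-Lipschitz functions, to the limit measure of some
discretization of rank at least `n₀`, for all starting points in a neighbourhood of some point of
`U`.

Density starts from any `f₀`. Expanding maps have specification (`exists_periodic_specification`),
and backward orbits are dense (`exists_mem_iterate_eq`). This gives a finite forward invariant set
`Z` of preperiodic points; the periodic measures reached from `Z ∩ U` approximate the invariant
measures not only of `f₀` but of all nearby maps (`exists_finset_approximating`). Once `Z` is fixed,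
a fine grid moves its points very little, so a `C^1`-small perturbation `f₁` sends the projection of
each `z` exactly to the projection of `f₀ z` (`eventually_exists_map_projection_eq`).

Openness comes from rounding: a map close enough to `f₁` still lands less than half a grid step from
the right grid point. Its discretization therefore follows the same finite dynamics
(`discretization_iterate_eq`), and points close to the projection of `z` start on that orbit.
Countably many choices of `U`, `ε` and `n₀` then suffice. -/

/-! ### Averages along eventually periodic sequences. -/

theorem integral_averageDirac {X : Type*} [MeasurableSpace X] [MeasurableSingletonClass X]
    (u : ℕ → X) (M : ℕ) (φ : X → ℝ) :
    ∫ x, φ x ∂(averageDirac u M : Measure X) =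
      (∑ m ∈ Finset.range (M + 1), φ (u m)) / ((M : ℝ) + 1) := by
  have h : (averageDirac u M : Measure X) =
      ((M + 1 : ℕ) : ENNReal)⁻¹ • ∑ m ∈ Finset.range (M + 1), Measure.dirac (u m) := rfl
  rw [h, integral_smul_measure, integral_finsetSum_measure]
  · simp only [integral_dirac, smul_eq_mul, ENNReal.toReal_inv, ENNReal.toReal_natCast]
    push_cast
    rw [div_eq_inv_mul]
  · intro i _
    exact integrable_dirac (by simp [enorm_lt_top])

/-- Subtracting the mean `a` over one period makes the partial sums `D` periodic from rank `m` on,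
hence bounded, and division by `M + 1` kills them. Writing the period as `T + 1` keeps it positive.
-/
theorem tendsto_cesaro_of_eventually_periodic (v : ℕ → ℝ) (m T : ℕ)
    (h : ∀ i, v (m + i + (T + 1)) = v (m + i)) :
    Tendsto (fun M : ℕ => (∑ i ∈ Finset.range (M + 1), v i) / ((M : ℝ) + 1)) atTop
      (𝓝 ((∑ i ∈ Finset.range (T + 1), v (m + i)) / ((T : ℝ) + 1))) := by
  set a := (∑ i ∈ Finset.range (T + 1), v (m + i)) / ((T : ℝ) + 1) with ha
  set D : ℕ → ℝ := fun M => ∑ i ∈ Finset.range M, (v i - a) with hD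
  have hT : ((T : ℝ) + 1) ≠ 0 := by positivity
  have hper : ∀ j, D (m + j + (T + 1)) = D (m + j) := by
    intro j
    induction j with
    | zero =>
      simp only [hD, add_zero]
      rw [Finset.sum_range_add, Finset.sum_sub_distrib _ (fun _ => a) (s := Finset.range (T + 1))]
      simp only [Finset.sum_const, Finset.card_range, nsmul_eq_mul]
      push_cast
      rw [ha, mul_div_cancel₀ _ hT]
      ring
    | succ j ih =>
      have e : m + (j + 1) + (T + 1) = (m + j + (T + 1)) + 1 := by ring
      rw [e, ← add_assoc m j 1]
      simp only [hD] at ih ⊢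
      rw [Finset.sum_range_succ, ih, h, Finset.sum_range_succ]
  set B := ∑ k ∈ Finset.range (m + (T + 1)), |D k| with hB
  have hbound : ∀ M, |D M| ≤ B := by
    intro M
    induction M using Nat.strong_induction_on with
    | _ M ih =>
      by_cases hM : M < m + (T + 1)
      · exact Finset.single_le_sum (f := fun k => |D k|) (fun _ _ => abs_nonneg _)
          (Finset.mem_range.2 hM)
      · have e : M = m + (M - (m + (T + 1))) + (T + 1) := by omega
        rw [e, hper]
        exact ih _ (by omega)
  have hlim : Tendsto (fun M : ℕ => a + D (M + 1) / ((M : ℝ) + 1)) atTop (𝓝 (a + 0)) := by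
    refine tendsto_const_nhds.add (squeeze_zero_norm (a := fun M : ℕ => B / ((M : ℝ) + 1)) ?_ ?_)
    · intro M
      rw [Real.norm_eq_abs, abs_div, abs_of_pos (by positivity : (0 : ℝ) < (M : ℝ) + 1)]
      gcongr
      exact hbound _
    · simpa [div_eq_mul_inv] using
        (tendsto_one_div_add_atTop_nhds_zero_nat (𝕜 := ℝ)).const_mul B
  rw [add_zero] at hlim
  refine hlim.congr fun M => ?_
  have hM : ((M : ℝ) + 1) ≠ 0 := by positivity
  simp only [hD, Finset.sum_sub_distrib, Finset.sum_const, Finset.card_range, nsmul_eq_mul]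
  push_cast
  field_simp
  ring

/-- The averages along an eventually periodic sequence converge to the average over a period. -/
theorem tendsto_averageDirac {X : Type*} [TopologicalSpace X] [MeasurableSpace X]
    [OpensMeasurableSpace X] [MeasurableSingletonClass X] (u : ℕ → X) (m T : ℕ)
    (h : ∀ i, u (m + i + (T + 1)) = u (m + i)) :
    Tendsto (averageDirac u) atTop (𝓝 (averageDirac (fun i => u (m + i)) T)) := by
  rw [ProbabilityMeasure.tendsto_iff_forall_integral_tendsto]
  intro φ
  simp only [integral_averageDirac]
  exact tendsto_cesaro_of_eventually_periodic (fun i => φ (u i)) m T fun i => by rw [h]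

/-! ### Finite samples of measures. -/

/-- Weights on a finite set are approximated by the uniform weights of a finite sample. -/
theorem exists_sample {S : Type*} [Fintype S] [Nonempty S] (w : S → ℝ) (hw : ∀ s, 0 ≤ w s)
    (hsum : ∑ s, w s = 1) (K : ℕ) :
    ∃ c : Fin K → S, ∀ (a : S → ℝ) (A : ℝ), (∀ s, |a s| ≤ A) →
      |K * ∑ s, w s * a s - ∑ j, a (c j)| ≤ 2 * Fintype.card S * A := by
  classical
  obtain ⟨s₀⟩ := ‹Nonempty S›
  -- Each `s` is repeated `⌊K * w s⌋` times and the `r` missing entries are filled with `s₀`. Both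
  -- the rounding and the filling cost at most `card S * A`. The sample is chosen before the test
  -- function `a`.
  let k : S → ℕ := fun s => ⌊K * w s⌋₊
  have hk : ∀ s, (k s : ℝ) ≤ K * w s := fun s =>
    Nat.floor_le (mul_nonneg (Nat.cast_nonneg _) (hw s))
  have hk' : ∀ s, K * w s - k s ≤ 1 := fun s => by
    have := (Nat.lt_floor_add_one (K * w s)).le
    simp only [k]; linarith
  have hKsum : ∑ s, K * w s = (K : ℝ) := by rw [← Finset.mul_sum, hsum, mul_one]
  have hle : ∑ s, k s ≤ K := by
    have : ((∑ s, k s : ℕ) : ℝ) ≤ K := by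
      push_cast
      rw [← hKsum]
      exact Finset.sum_le_sum fun s _ => hk s
    exact_mod_cast this
  obtain ⟨r, hr⟩ := Nat.exists_eq_add_of_le hle
  have hr' : (r : ℝ) = ∑ s, (K * w s - k s) := by
    rw [Finset.sum_sub_distrib, hKsum]
    have : (K : ℝ) = ∑ s, (k s : ℝ) + r := by exact_mod_cast hr
    linarith
  have hcard : Fintype.card (Fin K) = Fintype.card ((Σ s, Fin (k s)) ⊕ Fin r) := by
    simp [Fintype.card_sum, Fintype.card_sigma, ← hr]
  let e := Fintype.equivOfCardEq hcard
  refine ⟨fun j => Sum.elim (fun p => p.1) (fun _ => s₀) (e j), fun a A hA => ?_⟩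
  have hA0 : 0 ≤ A := (abs_nonneg _).trans (hA s₀)
  have hs : ∑ j, a (Sum.elim (fun p : Σ s, Fin (k s) => p.1) (fun _ => s₀) (e j)) =
      ∑ s, k s * a s + r * a s₀ := by
    rw [e.sum_comp (fun q => a (Sum.elim (fun p : Σ s, Fin (k s) => p.1) (fun _ => s₀) q)),
      Fintype.sum_sum_type, Fintype.sum_sigma]
    simp
  rw [hs]
  have hc : ∑ s : S, (K * w s - k s) ≤ Fintype.card S := by
    calc ∑ s : S, (K * w s - k s) ≤ ∑ _s : S, (1 : ℝ) := Finset.sum_le_sum fun s _ => hk' s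
      _ = _ := by simp
  have h1 : K * ∑ s, w s * a s - (∑ s, k s * a s + r * a s₀) =
      ∑ s, (K * w s - k s) * a s - r * a s₀ := by
    simp only [sub_mul, Finset.sum_sub_distrib, Finset.mul_sum, mul_assoc]
    ring
  rw [h1]
  have h2 : |∑ s, (K * w s - k s) * a s| ≤ Fintype.card S * A := by
    calc |∑ s, (K * w s - k s) * a s| ≤ ∑ s, |(K * w s - k s) * a s| :=
          Finset.abs_sum_le_sum_abs _ _
      _ ≤ ∑ s, (K * w s - k s) * A := by
          refine Finset.sum_le_sum fun s _ => ?_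
          rw [abs_mul, abs_of_nonneg (sub_nonneg.2 (hk s))]
          exact mul_le_mul_of_nonneg_left (hA s) (sub_nonneg.2 (hk s))
      _ = (∑ s, (K * w s - k s)) * A := by rw [Finset.sum_mul]
      _ ≤ _ := by gcongr
  have h3 : |r * a s₀| ≤ Fintype.card S * A := by
    rw [abs_mul, Nat.abs_cast]
    have : (r : ℝ) ≤ Fintype.card S := by rw [hr']; exact hc
    exact mul_le_mul this (hA s₀) (abs_nonneg _) (Nat.cast_nonneg _)
  calc _ ≤ |∑ s, (K * w s - k s) * a s| + |r * a s₀| := abs_sub _ _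
    _ ≤ _ := by linarith

/-- Every probability measure on a compact metric space is close to the uniform measure of a
sample with values in a finite set that depends only on the precision. -/
theorem exists_finset_sample {X : Type*} [MetricSpace X] [CompactSpace X] [Nonempty X]
    [MeasurableSpace X] [BorelSpace X] {δ : ℝ} (hδ : 0 < δ) :
    ∃ S : Finset X, ∀ (μ : Measure X) [IsProbabilityMeasure μ] (K : ℕ), 0 < K →
      ∃ c : Fin K → S, ∀ ψ : X → ℝ, Continuous ψ → ∀ e A : ℝ,
        (∀ x y, dist x y < δ → |ψ x - ψ y| ≤ e) → (∀ x, |ψ x| ≤ A) →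
        |∫ x, ψ x ∂μ - (∑ j, ψ (c j)) / K| ≤ e + 2 * S.card * A / K := by
  classical
  let q : ℕ → X := TopologicalSpace.denseSeq X
  obtain ⟨t, ht⟩ := (isCompact_univ : IsCompact (Set.univ : Set X)).elim_finite_subcover
    (fun k => Metric.ball (q k) δ) (fun _ => Metric.isOpen_ball) (by
      intro x _
      obtain ⟨k, hk⟩ :=
        (TopologicalSpace.denseRange_denseSeq X).exists_dist_lt x hδ
      exact Set.mem_iUnion.2 ⟨k, hk⟩)
  let N := t.sup id
  -- `g` moves points by less than `δ` and does not depend on `μ`; its range is the universal set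
  -- `S`, and what is sampled is the image of `μ` under `g`.
  let g : SimpleFunc X X := SimpleFunc.nearestPt q N
  have hg : ∀ x, dist (g x) x < δ := by
    intro x
    have hx := ht (Set.mem_univ x)
    simp only [Set.mem_iUnion] at hx
    obtain ⟨k, hk, hxk⟩ := hx
    have h1 := SimpleFunc.edist_nearestPt_le q x (Finset.le_sup (f := id) hk : k ≤ N)
    have h2 : dist (g x) x ≤ dist (q k) x := by
      rw [edist_dist, edist_dist] at h1
      exact (ENNReal.ofReal_le_ofReal_iff dist_nonneg).1 h1
    exact h2.trans_lt (by rw [dist_comm]; exact hxk)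
  refine ⟨g.range, fun μ _ K hK => ?_⟩
  have hne : Nonempty g.range := by
    obtain ⟨x⟩ := ‹Nonempty X›
    exact ⟨⟨g x, g.mem_range_self x⟩⟩
  have hint : ∀ ψ : X → ℝ,
      ∫ x, ψ (g x) ∂μ = ∑ s : g.range, μ.real (g ⁻¹' {(s : X)}) * ψ s := by
    intro ψ
    have h1 : ∀ x, ψ (g x) =
        ∑ s : g.range, (g ⁻¹' {(s : X)}).indicator (fun _ => ψ s) x := by
      intro x
      rw [Finset.sum_eq_single (⟨g x, g.mem_range_self x⟩ : g.range)]
      · simp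
      · intro s _ hs
        apply Set.indicator_of_notMem
        intro h
        exact hs (Subtype.ext h.symm)
      · simp
    simp_rw [h1]
    rw [integral_finsetSum]
    · refine Finset.sum_congr rfl fun s _ => ?_
      rw [integral_indicator_const _ (g.measurableSet_preimage _), smul_eq_mul]
    · intro s _
      exact (integrable_const _).indicator (g.measurableSet_preimage _)
  obtain ⟨c, hc⟩ := exists_sample (fun s : g.range => μ.real (g ⁻¹' {(s : X)}))
    (fun _ => measureReal_nonneg) (by simpa using (hint fun _ => 1).symm) K
  refine ⟨c, fun ψ hψ e A he hA => ?_⟩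
  have hK' : (0 : ℝ) < K := by exact_mod_cast hK
  have h1 : |∫ x, ψ x ∂μ - ∫ x, ψ (g x) ∂μ| ≤ e := by
    have i1 : Integrable ψ μ := hψ.integrable_of_hasCompactSupport (HasCompactSupport.of_compactSpace _)
    have i2 : Integrable (fun x => ψ (g x)) μ := by
      refine Integrable.of_bound (hψ.measurable.comp g.measurable).aestronglyMeasurable A ?_
      exact Eventually.of_forall fun x => hA _
    rw [← integral_sub i1 i2]
    have := norm_integral_le_of_norm_le_const (μ := μ) (f := fun x => ψ x - ψ (g x)) (C := e)
      (Eventually.of_forall fun x => he _ _ (by rw [dist_comm]; exact hg x))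
    simpa using this
  have h2 := hc (fun s => ψ s) A fun s => hA s
  rw [hint] at h1
  have h3 : |∑ s : g.range, μ.real (g ⁻¹' {(s : X)}) * ψ s - (∑ j, ψ (c j)) / K| ≤
      2 * g.range.card * A / K := by
    rw [Fintype.card_coe] at h2
    have e1 : ∑ s : g.range, μ.real (g ⁻¹' {(s : X)}) * ψ s - (∑ j, ψ (c j)) / K =
        (K * ∑ s : g.range, μ.real (g ⁻¹' {(s : X)}) * ψ s - ∑ j, ψ (c j)) / K := by
      field_simp
    rw [e1, abs_div, Nat.abs_cast]
    gcongr
  calc _ ≤ _ + _ := abs_sub_le _ _ _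
    _ ≤ _ := add_le_add h1 h3

/-! ### Shadowing and specification for expanding maps. -/

/-- An injective continuous function on the line is strictly monotone, and the lower bound on its
increments makes it unbounded on both sides. This solves the equations for connecting and closing
orbits in the lift. -/
theorem surjective_of_expanding {g : ℝ → ℝ} (hg : Continuous g) {c : ℝ} (hc : 0 < c)
    (h : ∀ a b, c * |a - b| ≤ |g a - g b|) : Function.Surjective g := by
  have hinj : Function.Injective g := by
    intro a b hab
    have := h a b
    rw [hab, sub_self, abs_zero] at this
    have h0 : |a - b| ≤ 0 := by
      by_contra hcon
      push Not at hcon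
      have := mul_pos hc hcon
      linarith
    exact sub_eq_zero.1 (abs_eq_zero.1 (le_antisymm h0 (abs_nonneg _)))
  have key : ∀ k : ℝ → ℝ, Continuous k → (∀ a b, c * |a - b| ≤ |k a - k b|) → StrictMono k →
      Function.Surjective k := by
    intro k hk h hm
    have hlin : ∀ a b, a ≤ b → k a + c * (b - a) ≤ k b := by
      intro a b hab
      have := h b a
      rw [abs_of_nonneg (sub_nonneg.2 hab), abs_of_nonneg (sub_nonneg.2 (hm.monotone hab))] at this
      linarith
    refine hk.surjective ?_ ?_
    · refine tendsto_atTop_mono' _ ?_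
        (tendsto_atTop_add_const_left _ (k 0) (tendsto_id.const_mul_atTop hc))
      filter_upwards [eventually_ge_atTop 0] with b hb
      simpa using hlin 0 b hb
    · refine tendsto_atBot_mono' _ ?_
        (tendsto_atBot_add_const_left _ (k 0) (tendsto_id.const_mul_atBot hc))
      filter_upwards [eventually_le_atBot 0] with b hb
      have := hlin b 0 hb
      simp only [id]
      linarith
  rcases hg.strictMono_of_inj hinj with hm | hm
  · exact key g hg h hm
  · intro y
    obtain ⟨x, hx⟩ := key (fun t => -g t) hg.neg (fun a b => by
      rw [neg_sub_neg, abs_sub_comm (g b)]; exact h a b) (fun a b hab => neg_lt_neg (hm hab)) (-y)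
    exact ⟨x, neg_injective hx⟩

theorem mul_pow_abs_sub_le_iterate {F : ℝ → ℝ} {lam : ℝ} (hlam : 0 ≤ lam)
    (h : ∀ a b, lam * |a - b| ≤ |F a - F b|) (n : ℕ) (a b : ℝ) :
    lam ^ n * |a - b| ≤ |F^[n] a - F^[n] b| := by
  induction n with
  | zero => simp
  | succ n ih =>
    rw [Function.iterate_succ_apply', Function.iterate_succ_apply', pow_succ', mul_assoc]
    exact (mul_le_mul_of_nonneg_left ih hlam).trans (h _ _)

theorem UnitAddCircle.dist_coe_le (a b : ℝ) :
    dist (a : UnitAddCircle) (b : UnitAddCircle) ≤ |a - b| := by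
  rw [dist_eq_norm, ← AddCircle.coe_sub, UnitAddCircle.norm_eq]
  have := round_le (a - b) 0
  simpa using this

theorem UnitAddCircle.exists_coe_eq_abs_eq_norm (x : UnitAddCircle) :
    ∃ r : ℝ, (r : UnitAddCircle) = x ∧ |r| = ‖x‖ := by
  obtain ⟨t, rfl⟩ := QuotientAddGroup.mk_surjective x
  refine ⟨t - round t, ?_, (UnitAddCircle.norm_eq).symm⟩
  rw [AddCircle.coe_sub]
  have : ((round t : ℝ) : UnitAddCircle) = 0 := by
    rw [AddCircle.coe_eq_zero_iff]
    exact ⟨round t, by simp⟩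
  rw [this, sub_zero]

/-- Shadowing errors decay geometrically backwards from the end of a segment, so their total is
bounded independently of its length. -/
theorem sum_range_inv_pow_sub_le {lam : ℝ} (hlam : 1 < lam) (n : ℕ) :
    ∑ i ∈ Finset.range n, (lam ^ (n - i))⁻¹ ≤ (lam - 1)⁻¹ := by
  have hpos : 0 < lam - 1 := by linarith
  have h : ∑ i ∈ Finset.range n, (lam ^ (n - i))⁻¹ = (lam - 1)⁻¹ * (1 - (lam ^ n)⁻¹) := by
    induction n with
    | zero => simp
    | succ n ih =>
      rw [Finset.sum_range_succ']
      simp only [Nat.add_sub_add_right, ih, Nat.sub_zero]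
      have : lam ≠ 0 := by linarith
      have : lam - 1 ≠ 0 := hpos.ne'
      field_simp
      ring
  rw [h]
  have : 0 < (lam ^ n)⁻¹ := by positivity
  have h2 : 0 < (lam - 1)⁻¹ := by positivity
  nlinarith

theorem Finset.sum_range_mul_eq (g : ℕ → ℝ) (K n : ℕ) :
    ∑ m ∈ Finset.range (K * n), g m =
      ∑ j ∈ Finset.range K, ∑ i ∈ Finset.range n, g (j * n + i) := by
  induction K with
  | zero => simp
  | succ K ih => rw [Nat.succ_mul, Finset.sum_range_add, ih, Finset.sum_range_succ]

namespace ExpandingCircleMap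

variable {d : ℤ}

/-- By the mean value theorem the lift expands all distances on the line, whereas on the circle
expansion is only local; shadowing is therefore done in the lift. -/
theorem exists_expanding_lift (f : ExpandingCircleMap d) :
    ∃ (F : ℝ → ℝ) (lam : ℝ), 1 < lam ∧ Continuous F ∧
      (∀ (n : ℕ) (t : ℝ), ((F^[n] t : ℝ) : UnitAddCircle) = f^[n] (t : UnitAddCircle)) ∧
      ∀ a b, lam * |a - b| ≤ |F a - F b| := by
  obtain ⟨F, hF, -, hF'⟩ := f.exists_lift
  obtain ⟨lam, hlam, hexp⟩ := f.expanding
  have hc : Continuous F := continuous_iff_continuousAt.2 fun t => (hF' t).continuousAt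
  refine ⟨F, lam, hlam, hc, ?_, ?_⟩
  · intro n t
    induction n with
    | zero => rfl
    | succ n ih => rw [Function.iterate_succ_apply', Function.iterate_succ_apply', hF, ih]
  · have key : ∀ a b, a < b → lam * |b - a| ≤ |F b - F a| := by
      intro a b hab
      obtain ⟨c, -, hcs⟩ := exists_hasDerivAt_eq_slope F _ hab hc.continuousOn fun t _ => hF' t
      have h1 := hexp (c : UnitAddCircle)
      rw [hcs, abs_div, le_div_iff₀ (abs_pos.2 (sub_ne_zero.2 hab.ne'))] at h1
      exact h1
    intro a b
    rcases lt_trichotomy a b with h | h | h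
    · rw [abs_sub_comm a, abs_sub_comm (F a)]
      exact key a b h
    · simp [h]
    · exact key b a h

/-- Every orbit segment is shadowed by an orbit segment that ends at a prescribed point. -/
theorem exists_connecting (f : ExpandingCircleMap d) :
    ∃ lam : ℝ, 1 < lam ∧ ∀ (x z : UnitAddCircle) (n : ℕ), ∃ y, f^[n] y = z ∧
      ∀ i ≤ n, dist (f^[i] y) (f^[i] x) ≤ 2⁻¹ * (lam ^ (n - i))⁻¹ := by
  obtain ⟨F, lam, hlam, hc, hF, hexp⟩ := f.exists_expanding_lift
  refine ⟨lam, hlam, fun x z n => ?_⟩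
  have hpos : 0 < lam := by linarith
  obtain ⟨a, rfl⟩ := QuotientAddGroup.mk_surjective x
  obtain ⟨r, hr, hr'⟩ := UnitAddCircle.exists_coe_eq_abs_eq_norm (z - (F^[n] a : ℝ))
  have hr2 : |r| ≤ 2⁻¹ := by
    rw [hr']
    simpa using AddCircle.norm_le_half_period (1 : ℝ) (x := z - (F^[n] a : ℝ)) one_ne_zero
  -- `F^[n] a + r` is the lift of `z` nearest to `F^[n] a`, at distance at most half the
  -- circumference. Each step back from time `n` divides this error by at least `lam`.
  obtain ⟨b, hb⟩ := (surjective_of_expanding hc hpos hexp).iterate n (F^[n] a + r)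
  refine ⟨b, ?_, fun i hi => ?_⟩
  · rw [← hF, hb, AddCircle.coe_add, hr]
    abel
  · have e1 : ((QuotientAddGroup.mk a : UnitAddCircle)) = (a : UnitAddCircle) := rfl
    rw [e1, ← hF, ← hF]
    refine (UnitAddCircle.dist_coe_le _ _).trans ?_
    rw [← div_eq_mul_inv, le_div_iff₀' (by positivity)]
    refine (mul_pow_abs_sub_le_iterate hpos.le hexp (n - i) _ _).trans ?_
    rw [← Function.iterate_add_apply, ← Function.iterate_add_apply, Nat.sub_add_cancel hi, hb,
      add_sub_cancel_left]
    exact hr2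

/-- Every orbit segment is shadowed by a periodic orbit. -/
theorem exists_closing (f : ExpandingCircleMap d) :
    ∃ lam r : ℝ, 1 < lam ∧ 0 ≤ r ∧ ∀ (x : UnitAddCircle) (n : ℕ), 0 < n → ∃ y, f^[n] y = y ∧
      ∀ i ≤ n, dist (f^[i] y) (f^[i] x) ≤ r * (lam ^ (n - i))⁻¹ := by
  obtain ⟨F, lam, hlam, hc, hF, hexp⟩ := f.exists_expanding_lift
  have hpos : 0 < lam := by linarith
  have hpos' : 0 < lam - 1 := by linarith
  refine ⟨lam, 2⁻¹ * lam / (lam - 1), hlam, by positivity, fun x n hn => ?_⟩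
  obtain ⟨a, rfl⟩ := QuotientAddGroup.mk_surjective x
  have hlamn : lam ≤ lam ^ n := by
    simpa using pow_le_pow_right₀ hlam.le (show 1 ≤ n from hn)
  have hexpn := mul_pow_abs_sub_le_iterate hpos.le hexp n
  -- A point is periodic on the circle when `F^[n] t - t` is an integer. This function expands
  -- distances by `lam - 1` because `n > 0`, so it attains the integer nearest to `F^[n] a - a`.
  obtain ⟨p, hp⟩ := surjective_of_expanding (g := fun t => F^[n] t - t)
    ((hc.iterate n).sub continuous_id) hpos' (fun s t => by
      have h1 : F^[n] s - s - (F^[n] t - t) = (F^[n] s - F^[n] t) - (s - t) := by ring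
      rw [h1]
      have h2 := abs_sub_abs_le_abs_sub (F^[n] s - F^[n] t) (s - t)
      have h3 := hexpn s t
      have h4 := mul_le_mul_of_nonneg_right hlamn (abs_nonneg (s - t))
      linarith) (round (F^[n] a - a) : ℝ)
  -- With `D` the left side, `D ≤ |p - a| + 1/2` and `lam * |p - a| ≤ D`; solving for `D` gives the
  -- constant.
  have hD : |F^[n] p - F^[n] a| ≤ 2⁻¹ * lam / (lam - 1) := by
    have h1 : F^[n] p - F^[n] a = (p - a) - ((F^[n] a - a) - round (F^[n] a - a)) := by
      rw [← hp]; ring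
    have h2 : |F^[n] p - F^[n] a| ≤ |p - a| + 1 / 2 := by
      conv_lhs => rw [h1]
      exact (abs_sub _ _).trans (add_le_add le_rfl (abs_sub_round _))
    have h3 := hexpn p a
    have h4 := mul_le_mul_of_nonneg_right hlamn (abs_nonneg (p - a))
    rw [le_div_iff₀ hpos']
    nlinarith
  refine ⟨p, ?_, fun i hi => ?_⟩
  · rw [← hF]
    have : F^[n] p = p + (round (F^[n] a - a) : ℝ) := by rw [← hp]; ring
    rw [this, AddCircle.coe_add, add_eq_left, AddCircle.coe_eq_zero_iff]
    exact ⟨round (F^[n] a - a), by simp⟩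
  · have e1 : ((QuotientAddGroup.mk a : UnitAddCircle)) = (a : UnitAddCircle) := rfl
    rw [e1, ← hF, ← hF]
    refine (UnitAddCircle.dist_coe_le _ _).trans ?_
    rw [← div_eq_mul_inv, le_div_iff₀' (by positivity)]
    refine (mul_pow_abs_sub_le_iterate hpos.le hexp (n - i) _ _).trans ?_
    rw [← Function.iterate_add_apply, ← Function.iterate_add_apply, Nat.sub_add_cancel hi]
    exact hD

/-- Connecting a point of `U` to `z` in `m` steps moves the starting point by at most `lam ^ (-m) /
2`, which stays inside `U` for large `m`. -/
theorem exists_mem_iterate_eq (f : ExpandingCircleMap d) {U : Set UnitAddCircle} (hU : IsOpen U)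
    (hne : U.Nonempty) (z : UnitAddCircle) : ∃ y ∈ U, ∃ m : ℕ, f^[m] y = z := by
  obtain ⟨lam, hlam, h⟩ := f.exists_connecting
  obtain ⟨x, hx⟩ := hne
  obtain ⟨ε, hε, hball⟩ := Metric.isOpen_iff.1 hU x hx
  have hlim : Tendsto (fun n : ℕ => 2⁻¹ * (lam ^ n)⁻¹) atTop (𝓝 (2⁻¹ * 0)) :=
    ((tendsto_pow_atTop_atTop_of_one_lt hlam).inv_tendsto_atTop).const_mul _
  rw [mul_zero] at hlim
  obtain ⟨m, hm⟩ := (hlim.eventually_lt_const hε).exists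
  obtain ⟨y, hy, hd⟩ := h x z m
  exact ⟨y, hball ((hd 0 (Nat.zero_le _)).trans_lt hm), m, hy⟩

theorem exists_sum_dist_connecting_le (f : ExpandingCircleMap d) :
    ∃ C : ℝ, 0 ≤ C ∧ ∀ (x z : UnitAddCircle) (n : ℕ), ∃ y, f^[n] y = z ∧
      ∑ i ∈ Finset.range n, dist (f^[i] y) (f^[i] x) ≤ C := by
  obtain ⟨lam, hlam, h⟩ := f.exists_connecting
  have hpos : 0 < lam - 1 := by linarith
  refine ⟨2⁻¹ * (lam - 1)⁻¹, by positivity, fun x z n => ?_⟩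
  obtain ⟨y, hy, hd⟩ := h x z n
  refine ⟨y, hy, (Finset.sum_le_sum fun i hi => hd i (Finset.mem_range.1 hi).le).trans ?_⟩
  rw [← Finset.mul_sum]
  exact mul_le_mul_of_nonneg_left (sum_range_inv_pow_sub_le hlam n) (by norm_num)

theorem exists_sum_dist_closing_le (f : ExpandingCircleMap d) :
    ∃ C : ℝ, 0 ≤ C ∧ ∀ (x : UnitAddCircle) (n : ℕ), 0 < n → ∃ y, f^[n] y = y ∧
      ∑ i ∈ Finset.range n, dist (f^[i] y) (f^[i] x) ≤ C := by
  obtain ⟨lam, r, hlam, hr, h⟩ := f.exists_closing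
  have hpos : 0 < lam - 1 := by linarith
  refine ⟨r * (lam - 1)⁻¹, by positivity, fun x n hn => ?_⟩
  obtain ⟨y, hy, hd⟩ := h x n hn
  refine ⟨y, hy, (Finset.sum_le_sum fun i hi => hd i (Finset.mem_range.1 hi).le).trans ?_⟩
  rw [← Finset.mul_sum]
  exact mul_le_mul_of_nonneg_left (sum_range_inv_pow_sub_le hlam n) hr

/-- Specification: finitely many orbit segments of the same length are shadowed one after the
other by a single periodic orbit. -/
theorem exists_periodic_specification (f : ExpandingCircleMap d) :
    ∃ C : ℝ, 0 ≤ C ∧ ∀ (K n : ℕ) (x : ℕ → UnitAddCircle), 0 < K → 0 < n →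
      ∃ p, f^[K * n] p = p ∧ ∑ j ∈ Finset.range K, ∑ i ∈ Finset.range n,
        dist (f^[j * n + i] p) (f^[i] (x j)) ≤ K * C := by
  obtain ⟨C, hC, h⟩ := f.exists_sum_dist_connecting_le
  obtain ⟨C', hC', h'⟩ := f.exists_sum_dist_closing_le
  -- Blocks are prepended: the new block ends exactly at the point `y'` that shadows the remaining
  -- ones, so their errors do not change and each block costs only `C`.
  have key : ∀ (n K : ℕ) (x : ℕ → UnitAddCircle), ∃ y, ∑ j ∈ Finset.range K,
      ∑ i ∈ Finset.range n, dist (f^[j * n + i] y) (f^[i] (x j)) ≤ K * C := by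
    intro n K
    induction K with
    | zero => intro x; exact ⟨0, by simp⟩
    | succ K ih =>
      intro x
      obtain ⟨y', hy'⟩ := ih fun j => x (j + 1)
      obtain ⟨y, hy, hd⟩ := h (x 0) y' n
      refine ⟨y, ?_⟩
      rw [Finset.sum_range_succ']
      have e : ∀ j i, f^[(j + 1) * n + i] y = f^[j * n + i] y' := by
        intro j i
        rw [← hy, ← Function.iterate_add_apply]
        congr 1
        ring
      simp only [e, zero_mul, zero_add]
      push_cast
      linarith
  -- The orbit is closed only once, at cost `C'`, which is at most `K * C'`.
  refine ⟨C + C', by positivity, fun K n x hK hn => ?_⟩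
  obtain ⟨y, hy⟩ := key n K x
  obtain ⟨p, hp, hpd⟩ := h' y (K * n) (Nat.mul_pos hK hn)
  refine ⟨p, hp, ?_⟩
  rw [Finset.sum_range_mul_eq (fun m => dist (f^[m] p) (f^[m] y))] at hpd
  calc _ ≤ ∑ j ∈ Finset.range K, ∑ i ∈ Finset.range n,
        (dist (f^[j * n + i] p) (f^[j * n + i] y) + dist (f^[j * n + i] y) (f^[i] (x j))) :=
        Finset.sum_le_sum fun j _ => Finset.sum_le_sum fun i _ => dist_triangle _ _ _
    _ ≤ C' + K * C := by
        simp only [Finset.sum_add_distrib]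
        exact add_le_add hpd hy
    _ ≤ K * (C + C') := by
        have : (1 : ℝ) ≤ K := by exact_mod_cast hK
        nlinarith

end ExpandingCircleMap

/-! ### Geometry of the grid. -/

theorem nsmul_eq_zero_of_mem_circleGrid {N : ℕ+} {y : UnitAddCircle} (hy : y ∈ circleGrid N) :
    (N : ℕ) • y = 0 := by
  obtain ⟨i, -, -, rfl⟩ := hy
  rw [← AddCircle.coe_nsmul, AddCircle.coe_eq_zero_iff]
  refine ⟨i, ?_⟩
  have : ((N : ℕ) : ℝ) ≠ 0 := by exact_mod_cast N.ne_zero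
  simp only [zsmul_eq_mul, mul_one, nsmul_eq_mul, Int.cast_natCast]
  field_simp

/-- The difference of two grid points is `N`-torsion, and a nonzero element of finite order `k` has
norm at least `1 / k`. -/
theorem eq_of_mem_circleGrid_of_dist_lt {N : ℕ+} {y z : UnitAddCircle} (hy : y ∈ circleGrid N)
    (hz : z ∈ circleGrid N) (h : dist y z < 1 / (N : ℕ)) : y = z := by
  by_contra hne
  have hN : (0 : ℝ) < (N : ℕ) := by exact_mod_cast N.pos
  have h0 : (N : ℕ) • (y - z) = 0 := by
    rw [smul_sub, nsmul_eq_zero_of_mem_circleGrid hy, nsmul_eq_zero_of_mem_circleGrid hz, sub_zero]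
  have hfin : IsOfFinAddOrder (y - z) := isOfFinAddOrder_iff_nsmul_eq_zero.2 ⟨N, N.pos, h0⟩
  have h1 := AddCircle.le_add_order_smul_norm_of_isOfFinAddOrder hfin (sub_ne_zero.2 hne)
  have h2 : (addOrderOf (y - z) : ℝ) ≤ (N : ℕ) := by
    exact_mod_cast Nat.le_of_dvd N.pos (addOrderOf_dvd_of_nsmul_eq_zero h0)
  rw [dist_eq_norm, lt_div_iff₀ hN] at h
  rw [nsmul_eq_mul] at h1
  nlinarith [norm_nonneg (y - z)]

/-- Strictly within half a grid step there are no ties. This makes the discretization stable under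
small changes of the map and of the starting point. -/
theorem IsNearestPointProjection.eq_of_dist_lt {N : ℕ+} {P : UnitAddCircle → circleGrid N}
    (hP : IsNearestPointProjection N P) {x y : UnitAddCircle} (hy : y ∈ circleGrid N)
    (h : dist x y < 1 / (2 * (N : ℕ))) : (P x : UnitAddCircle) = y := by
  refine eq_of_mem_circleGrid_of_dist_lt (P x).2 hy ?_
  have h1 := hP x y hy
  have h2 := dist_triangle_left (P x : UnitAddCircle) y x
  have h3 : (1 : ℝ) / (N : ℕ) = 1 / (2 * (N : ℕ)) + 1 / (2 * (N : ℕ)) := by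
    have : ((N : ℕ) : ℝ) ≠ 0 := by exact_mod_cast N.ne_zero
    field_simp
    norm_num
  linarith

theorem IsNearestPointProjection.dist_le {N : ℕ+} {P : UnitAddCircle → circleGrid N}
    (hP : IsNearestPointProjection N P) (x : UnitAddCircle) :
    dist x (P x : UnitAddCircle) ≤ 1 / (N : ℕ) := by
  have hN : (0 : ℝ) < (N : ℕ) := by exact_mod_cast N.pos
  obtain ⟨s, rfl⟩ := QuotientAddGroup.mk_surjective x
  -- The representative is taken in `(0, 1]` so that the ceiling of `t * N` is an admissible index
  -- between `1` and `N`.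
  obtain ⟨t, ht0, ht1, hts⟩ : ∃ t : ℝ, 0 < t ∧ t ≤ 1 ∧
      (t : UnitAddCircle) = (QuotientAddGroup.mk s : UnitAddCircle) := by
    refine ⟨s - (⌈s⌉ - 1), by linarith [Int.ceil_lt_add_one s], by linarith [Int.le_ceil s], ?_⟩
    rw [AddCircle.coe_sub, sub_eq_self, AddCircle.coe_eq_zero_iff]
    exact ⟨⌈s⌉ - 1, by simp⟩
  rw [← hts]
  have hpos : 0 < t * (N : ℕ) := mul_pos ht0 hN
  refine (hP t ((⌈t * (N : ℕ)⌉₊ / (N : ℕ) : ℝ) : UnitAddCircle)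
    ⟨⌈t * (N : ℕ)⌉₊, Nat.ceil_pos.2 hpos, ?_, rfl⟩).trans ?_
  · refine Nat.ceil_le.2 ?_
    nlinarith
  · refine (UnitAddCircle.dist_coe_le _ _).trans ?_
    have h1 := Nat.le_ceil (t * (N : ℕ))
    have h2 := Nat.ceil_lt_add_one hpos.le
    have h3 : t - (⌈t * (N : ℕ)⌉₊ : ℝ) / (N : ℕ) = (t * (N : ℕ) - ⌈t * (N : ℕ)⌉₊) / (N : ℕ) := by
      field_simp
    rw [h3, abs_div, abs_of_pos hN]
    gcongr
    rw [abs_le]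
    constructor <;> linarith

/-! ### Bump functions and `C^1`-small perturbations. -/

/-- A bump at `1` on the line is composed with the cosine of `2π(x - w)`, which is periodic and
equals `1` only at `w`. Being constant near each point of `Z`, the result takes its exact values `0`
and `1` at nearby grid points too. -/
theorem UnitAddCircle.exists_bump (w : UnitAddCircle) (Z : Finset UnitAddCircle) :
    ∃ g g' : C(UnitAddCircle, ℝ), (∀ t : ℝ, HasDerivAt (fun s : ℝ => g s) (g' t) t) ∧
      (∀ᶠ x in 𝓝 w, g x = 1) ∧ ∀ z ∈ Z, z ≠ w → ∀ᶠ x in 𝓝 z, g x = 0 := by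
  let c : C(UnitAddCircle, ℝ) := ⟨fun x => ((x - w).toCircle : ℂ).re, by fun_prop⟩
  let c' : C(UnitAddCircle, ℝ) := ⟨fun x => -(2 * Real.pi) * ((x - w).toCircle : ℂ).im, by fun_prop⟩
  have hcirc : ∀ a t : ℝ, (AddCircle.toCircle ((t : UnitAddCircle) - (a : UnitAddCircle)) : ℂ) =
      Complex.exp ((2 * Real.pi * (t - a) : ℝ) * Complex.I) := by
    intro a t
    rw [← AddCircle.coe_sub, AddCircle.toCircle_apply_mk, Circle.coe_exp]
    simp
  have hcw : c w = 1 := by simp [c]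
  have hc1 : ∀ z, z ≠ w → c z ≠ 1 := by
    intro z hz h
    apply hz
    have h1 : ((z - w).toCircle : ℂ).re = 1 := h
    have h2 : Complex.normSq ((z - w).toCircle : ℂ) = 1 := Circle.normSq_coe _
    rw [Complex.normSq_apply, h1] at h2
    have h3 : ((z - w).toCircle : ℂ).im = 0 := by nlinarith
    have h4 : (z - w).toCircle = AddCircle.toCircle (0 : UnitAddCircle) := by
      rw [AddCircle.toCircle_zero]
      exact Circle.ext (Complex.ext (by simpa using h1) (by simpa using h3))
    exact sub_eq_zero.1 (AddCircle.injective_toCircle one_ne_zero h4)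
  obtain ⟨ρ, hρ, hρZ⟩ : ∃ ρ : ℝ, 0 < ρ ∧ ∀ z ∈ Z, z ≠ w → ρ < dist (c z) 1 := by
    have h : ∀ᶠ ρ in 𝓝[>] (0 : ℝ), ∀ z ∈ Z, z ≠ w → ρ < dist (c z) 1 := by
      rw [Filter.eventually_all_finset]
      intro z _
      by_cases hz : z = w
      · simp [hz]
      · filter_upwards [nhdsWithin_le_nhds (Iio_mem_nhds (dist_pos.2 (hc1 z hz)))] with ρ h _
        exact h
    obtain ⟨ρ, h1, h2⟩ := (h.and self_mem_nhdsWithin).exists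
    exact ⟨ρ, h2, h1⟩
  let b : ContDiffBump (1 : ℝ) := ⟨ρ / 2, ρ, by positivity, by linarith⟩
  have hb : ContDiff ℝ 1 b := b.contDiff
  refine ⟨⟨fun x => b (c x), b.continuous.comp c.continuous⟩,
    ⟨fun x => deriv b (c x) * c' x, ((hb.continuous_deriv le_rfl).comp c.continuous).mul
      c'.continuous⟩, ?_, ?_, ?_⟩
  · intro t
    obtain ⟨a, rfl⟩ := QuotientAddGroup.mk_surjective w
    have hcd : HasDerivAt (fun s : ℝ => c s) (c' t) t := by
      have e1 : (fun s : ℝ => c s) = fun s => Real.cos (2 * Real.pi * (s - a)) := by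
        funext s
        change (AddCircle.toCircle ((s : UnitAddCircle) - (a : UnitAddCircle)) : ℂ).re = _
        rw [hcirc, Complex.exp_ofReal_mul_I_re]
      have e2 : c' t = -Real.sin (2 * Real.pi * (t - a)) * (2 * Real.pi) := by
        change -(2 * Real.pi) * (AddCircle.toCircle ((t : UnitAddCircle) - (a : UnitAddCircle)) : ℂ).im = _
        rw [hcirc, Complex.exp_ofReal_mul_I_im]
        ring
      rw [e1, e2]
      have := (((hasDerivAt_id t).sub_const a).const_mul (2 * Real.pi)).cos
      simpa using this
    exact ((hb.differentiable one_ne_zero).differentiableAt.hasDerivAt).comp t hcd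
  · have : ∀ᶠ s in 𝓝 (c w), b s = 1 := by
      rw [hcw]
      exact b.eventuallyEq_one
    exact c.continuous.continuousAt.eventually this
  · intro z hz hzw
    have h1 : ∀ᶠ x in 𝓝 z, ρ < dist (c x) 1 :=
      (c.continuous.dist continuous_const).continuousAt.eventually_const_lt (hρZ z hz hzw)
    filter_upwards [h1] with x hx
    exact b.zero_of_le_dist hx.le

namespace ExpandingCircleMap

variable {d : ℤ}

/-- A `C^1`-small function may be added to an expanding map. -/
theorem exists_perturbation (f : ExpandingCircleMap d) {V : Set (ExpandingCircleMap d)}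
    (hV : V ∈ 𝓝 f) : ∃ η : ℝ, 0 < η ∧ ∀ g g' : C(UnitAddCircle, ℝ),
      (∀ t : ℝ, HasDerivAt (fun s : ℝ => g s) (g' t) t) → ‖g‖ < η → ‖g'‖ < η →
      ∃ f₁ ∈ V, ∀ x, f₁ x = f x + (g x : UnitAddCircle) := by
  obtain ⟨u, hu, huV⟩ := (mem_nhds_induced _ _ _).1 hV
  obtain ⟨η, hη, hball⟩ := Metric.mem_nhds_iff.1 hu
  obtain ⟨F, hF, hFd, hF'⟩ := f.exists_lift
  obtain ⟨lam, hlam, hexp⟩ := f.expanding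
  -- Half of the margin `lam - 1` is spent, so the perturbed map stays expanding. The degree is
  -- unchanged because `g` is a function on the circle.
  refine ⟨min η ((lam - 1) / 2), lt_min hη (by linarith), fun g g' hg h1 h2 => ?_⟩
  have hcoe : Continuous fun x => ((g x : ℝ) : UnitAddCircle) :=
    (AddCircle.continuous_mk' 1).comp g.continuous
  refine ⟨⟨⟨fun x => f x + (g x : UnitAddCircle), f.toMap.continuous.add hcoe⟩,
    f.derivMap + g', ⟨fun t => F t + g t, ?_, ?_, ?_⟩, ⟨lam - (lam - 1) / 2, by linarith, ?_⟩⟩,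
    huV (hball ?_), fun x => rfl⟩
  · intro t
    rw [AddCircle.coe_add, hF]
    rfl
  · intro t
    have : ((t + 1 : ℝ) : UnitAddCircle) = t := AddCircle.coe_add_period 1 t
    simp only [hFd, this]
    ring
  · intro t
    exact (hF' t).add (hg t)
  · intro x
    have h3 := hexp x
    have h4 : |g' x| ≤ (lam - 1) / 2 :=
      (g'.norm_coe_le_norm x).trans (h2.le.trans (min_le_right _ _))
    have h5 := abs_sub_abs_le_abs_sub (f.derivMap x) (-g' x)
    rw [sub_neg_eq_add, abs_neg] at h5
    simp only [ContinuousMap.add_apply]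
    linarith
  · rw [Metric.mem_ball, Prod.dist_eq, max_lt_iff]
    constructor
    · rw [ContinuousMap.dist_lt_iff hη]
      intro x
      change dist (f x + (g x : UnitAddCircle)) (f x) < η
      rw [dist_eq_norm, add_sub_cancel_left]
      have h3 : ‖((g x : ℝ) : UnitAddCircle)‖ ≤ |g x| := by
        have := UnitAddCircle.dist_coe_le (g x) 0
        simpa using this
      exact (h3.trans (g.norm_coe_le_norm x)).trans_lt (h1.trans_le (min_le_left _ _))
    · rw [dist_eq_norm, add_sub_cancel_left]
      exact h2.trans_le (min_le_left _ _)

theorem tendsto_projection {P : (N : ℕ+) → UnitAddCircle → circleGrid N}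
    (hP : ∀ N : ℕ+, IsNearestPointProjection N (P N)) (x : UnitAddCircle) :
    Tendsto (fun n : ℕ => (P n.succPNat x : UnitAddCircle)) atTop (𝓝 x) := by
  rw [tendsto_iff_dist_tendsto_zero]
  refine squeeze_zero (fun _ => dist_nonneg) (fun n => ?_)
    (tendsto_one_div_add_atTop_nhds_zero_nat (𝕜 := ℝ))
  have := (hP n.succPNat).dist_le x
  rw [dist_comm]
  simpa using this

/-- After a `C^1`-small perturbation the dynamics on a finite invariant set is realised on the
projection of that set to a fine grid. -/
theorem eventually_exists_map_projection_eq {P : (N : ℕ+) → UnitAddCircle → circleGrid N}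
    (hP : ∀ N : ℕ+, IsNearestPointProjection N (P N)) (f : ExpandingCircleMap d)
    (Z : Finset UnitAddCircle) {V : Set (ExpandingCircleMap d)} (hV : V ∈ 𝓝 f) :
    ∀ᶠ n : ℕ in atTop, ∃ f₁ ∈ V, ∀ z ∈ Z,
      f₁ (P n.succPNat z : UnitAddCircle) = (P n.succPNat (f z) : UnitAddCircle) := by
  classical
  obtain ⟨η, hη, hpert⟩ := f.exists_perturbation hV
  choose g g' hg hg1 hg0 using fun w => UnitAddCircle.exists_bump w Z
  choose r hr hr' using UnitAddCircle.exists_coe_eq_abs_eq_norm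
  let p : ℕ → UnitAddCircle → UnitAddCircle := fun n x => P n.succPNat x
  have hp : ∀ x, Tendsto (fun n => p n x) atTop (𝓝 x) := tendsto_projection hP
  -- `a n w` is the correction needed at the projection of `w` to hit the projection of `f w`; it
  -- tends to `0` by continuity of `f`.
  let a : ℕ → UnitAddCircle → ℝ := fun n w => r (p n (f w) - f (p n w))
  have ha : ∀ w, Tendsto (fun n => a n w) atTop (𝓝 0) := by
    intro w
    rw [tendsto_zero_iff_norm_tendsto_zero]
    have h1 : Tendsto (fun n => ‖p n (f w) - f (p n w)‖) atTop (𝓝 ‖f w - f w‖) :=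
      ((hp (f w)).sub ((f.toMap.continuous.tendsto w).comp (hp w))).norm
    rw [sub_self, norm_zero] at h1
    exact h1.congr fun n => (hr' _).symm
  -- The bumps depend on `Z` only, not on the grid. With coefficients tending to `0`, the
  -- corrections and their derivatives both become uniformly small.
  have hsum : ∀ k : UnitAddCircle → C(UnitAddCircle, ℝ),
      ∀ᶠ n in atTop, ‖∑ w ∈ Z, a n w • k w‖ < η := by
    intro k
    have h1 : Tendsto (fun n => ∑ w ∈ Z, a n w • k w) atTop (𝓝 (∑ w ∈ Z, (0 : ℝ) • k w)) :=
      tendsto_finsetSum _ fun w _ => (ha w).smul_const (k w)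
    have h2 := h1.norm
    simp only [zero_smul, Finset.sum_const_zero, norm_zero] at h2
    exact h2.eventually_lt_const hη
  have hone : ∀ᶠ n in atTop, ∀ z ∈ Z, g z (p n z) = 1 := by
    rw [Filter.eventually_all_finset]
    exact fun z _ => (hp z).eventually (hg1 z)
  have hzero : ∀ᶠ n in atTop, ∀ z ∈ Z, ∀ w ∈ Z, z ≠ w → g w (p n z) = 0 := by
    rw [Filter.eventually_all_finset]
    intro z hz
    rw [Filter.eventually_all_finset]
    intro w _
    by_cases h : z = w
    · simp [h]
    · filter_upwards [(hp z).eventually (hg0 w z hz h)] with n hn _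
      exact hn
  filter_upwards [hsum g, hsum g', hone, hzero] with n h1 h2 h3 h4
  obtain ⟨f₁, hf₁, hf₁'⟩ := hpert (∑ w ∈ Z, a n w • g w) (∑ w ∈ Z, a n w • g' w) (by
    intro t
    simp only [ContinuousMap.coe_sum, ContinuousMap.coe_smul, Finset.sum_apply, Pi.smul_apply,
      smul_eq_mul]
    exact HasDerivAt.fun_sum fun w _ => (hg w t).const_mul _) h1 h2
  refine ⟨f₁, hf₁, fun z hz => ?_⟩
  have h5 : (∑ w ∈ Z, a n w • g w) (p n z) = a n z := by
    simp only [ContinuousMap.coe_sum, ContinuousMap.coe_smul, Finset.sum_apply, Pi.smul_apply,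
      smul_eq_mul]
    rw [Finset.sum_eq_single z]
    · rw [h3 z hz, mul_one]
    · intro w hw hwz
      rw [h4 z hz w hw hwz.symm, mul_zero]
    · exact fun h => absurd hz h
  change f₁ (p n z) = p n (f z)
  rw [hf₁', h5, hr]
  abel

end ExpandingCircleMap

/-! ### Approximating the invariant measures of all nearby maps. -/

theorem abs_average_sub_average_le {n : ℕ} (hn : 0 < n) {a b : ℕ → ℝ} {e : ℝ}
    (h : ∀ i < n, |a i - b i| ≤ e) :
    |(∑ i ∈ Finset.range n, a i) / n - (∑ i ∈ Finset.range n, b i) / n| ≤ e := by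
  have hn' : (0 : ℝ) < n := by exact_mod_cast hn
  rw [← sub_div, ← Finset.sum_sub_distrib, abs_div, Nat.abs_cast, div_le_iff₀ hn']
  calc _ ≤ ∑ i ∈ Finset.range n, |a i - b i| := Finset.abs_sum_le_sum_abs _ _
    _ ≤ ∑ _i ∈ Finset.range n, e := Finset.sum_le_sum fun i hi => h i (Finset.mem_range.1 hi)
    _ = e * n := by simp [mul_comm]

theorem Continuous.integrable_of_compactSpace {X : Type*} [TopologicalSpace X] [CompactSpace X]
    [MeasurableSpace X] [BorelSpace X] {μ : Measure X} [IsFiniteMeasure μ] {φ : X → ℝ}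
    (hφ : Continuous φ) : Integrable φ μ :=
  hφ.integrable_of_hasCompactSupport (HasCompactSupport.of_compactSpace _)

theorem abs_integral_sub_integral_le {X : Type*} [TopologicalSpace X] [CompactSpace X]
    [MeasurableSpace X] [BorelSpace X] {μ : Measure X} [IsProbabilityMeasure μ] {a b : X → ℝ}
    (ha : Continuous a) (hb : Continuous b) {e : ℝ} (h : ∀ x, |a x - b x| ≤ e) :
    |∫ x, a x ∂μ - ∫ x, b x ∂μ| ≤ e := by
  rw [← integral_sub ha.integrable_of_compactSpace hb.integrable_of_compactSpace]
  have := norm_integral_le_of_norm_le_const (μ := μ) (f := fun x => a x - b x) (C := e)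
    (Eventually.of_forall h)
  simpa using this

theorem LipschitzWith.abs_sub_le_dist {X : Type*} [PseudoMetricSpace X] {φ : X → ℝ}
    (hφ : LipschitzWith 1 φ) (x y : X) : |φ x - φ y| ≤ dist x y := by
  simpa [Real.dist_eq] using hφ.dist_le_mul x y

namespace ExpandingCircleMap

variable {d : ℤ}

theorem continuous_toMap :
    Continuous (toMap : ExpandingCircleMap d → C(UnitAddCircle, UnitAddCircle)) :=
  continuous_fst.comp
    (continuous_induced_dom (f := fun f : ExpandingCircleMap d => (f.toMap, f.derivMap)))

theorem continuous_iterate_apply (f : ExpandingCircleMap d) (i : ℕ) :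
    Continuous fun x => f^[i] x :=
  f.toMap.continuous.iterate i

theorem eventually_dist_iterate_le (f : ExpandingCircleMap d) (n : ℕ) {ε : ℝ} (hε : 0 < ε) :
    ∀ᶠ f' : ExpandingCircleMap d in 𝓝 f, ∀ i < n, ∀ x, dist (f'^[i] x) (f^[i] x) ≤ ε := by
  have hit : ∀ i : ℕ, ∃ h : ExpandingCircleMap d → C(UnitAddCircle, UnitAddCircle),
      Continuous h ∧ ∀ f' x, h f' x = f'^[i] x := by
    intro i
    induction i with
    | zero => exact ⟨fun _ => ContinuousMap.id _, continuous_const, fun _ _ => rfl⟩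
    | succ i ih =>
      obtain ⟨h, hc, hh⟩ := ih
      refine ⟨fun f' => f'.toMap.comp (h f'), ?_, fun f' x => ?_⟩
      · exact continuous_toMap.compCM hc
      · rw [Function.iterate_succ_apply', ← hh]
        rfl
  have h2 : ∀ᶠ f' : ExpandingCircleMap d in 𝓝 f, ∀ i ∈ Finset.range n, ∀ x, dist (f'^[i] x) (f^[i] x) ≤ ε := by
    rw [Filter.eventually_all_finset]
    intro i _
    obtain ⟨h, hc, hh⟩ := hit i
    filter_upwards [Metric.tendsto_nhds.1 (hc.tendsto f) ε hε] with f' hf' x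
    rw [← hh, ← hh]
    exact (ContinuousMap.dist_apply_le_dist x).trans hf'.le
  filter_upwards [h2] with f' hf' i hi
  exact hf' i (Finset.mem_range.2 hi)

theorem exists_equicontinuous_iterate (f : ExpandingCircleMap d) (n : ℕ) {ε : ℝ} (hε : 0 < ε) :
    ∃ δ > 0, ∀ x y, dist x y < δ → ∀ i < n, dist (f^[i] x) (f^[i] y) ≤ ε := by
  have h : ∀ᶠ δ in 𝓝[>] (0 : ℝ), ∀ i ∈ Finset.range n,
      ∀ x y, dist x y < δ → dist (f^[i] x) (f^[i] y) ≤ ε := by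
    rw [Filter.eventually_all_finset]
    intro i _
    obtain ⟨δ, hδ, h⟩ := Metric.uniformContinuous_iff.1
      (CompactSpace.uniformContinuous_of_continuous (f.continuous_iterate_apply i)) ε hε
    filter_upwards [Ioc_mem_nhdsGT hδ] with δ' hδ' x y hxy
    exact (h (hxy.trans_le hδ'.2)).le
  obtain ⟨δ, h1, h2⟩ := (h.and self_mem_nhdsWithin).exists
  exact ⟨δ, h2, fun x y hxy i hi => h1 i (Finset.mem_range.2 hi) x y hxy⟩

/-- Integrals against an invariant measure of a nearby map are approximated by integrals of finite
Birkhoff averages. -/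
theorem abs_integral_sub_integral_average_le {f f' : ExpandingCircleMap d} {n : ℕ} (hn : 0 < n)
    {ε : ℝ} (hd : ∀ i < n, ∀ x, dist (f'^[i] x) (f^[i] x) ≤ ε) {μ : Measure UnitAddCircle}
    [IsProbabilityMeasure μ] (hμ : MeasurePreserving f' μ μ) {φ : UnitAddCircle → ℝ}
    (hφ : LipschitzWith 1 φ) :
    |∫ x, φ x ∂μ - ∫ x, (∑ i ∈ Finset.range n, φ (f^[i] x)) / n ∂μ| ≤ ε := by
  have hn' : (n : ℝ) ≠ 0 := by exact_mod_cast hn.ne'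
  have hc : ∀ (g : ExpandingCircleMap d) i, Continuous fun x => φ (g^[i] x) := fun g i =>
    hφ.continuous.comp (g.continuous_iterate_apply i)
  have h1 : ∫ x, φ x ∂μ = (∑ i ∈ Finset.range n, ∫ x, φ (f'^[i] x) ∂μ) / n := by
    have : ∀ i, ∫ x, φ (f'^[i] x) ∂μ = ∫ x, φ x ∂μ := by
      intro i
      have h2 := hμ.iterate i
      conv_rhs => rw [← h2.map_eq]
      rw [integral_map h2.measurable.aemeasurable hφ.continuous.aestronglyMeasurable]
    simp only [this, Finset.sum_const, Finset.card_range, nsmul_eq_mul]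
    field_simp
  rw [h1, integral_div, integral_finsetSum _ fun i _ => (hc f i).integrable_of_compactSpace]
  exact abs_average_sub_average_le hn fun i hi => abs_integral_sub_integral_le (hc f' i) (hc f i)
    fun x => (hφ.abs_sub_le_dist _ _).trans (hd i hi x)

/-- A finite invariant set of eventually periodic points, found in a prescribed open set, whose
periodic measures approximate all the invariant measures of all nearby maps. -/
theorem exists_finset_approximating (f : ExpandingCircleMap d) {U : Set UnitAddCircle}
    (hU : IsOpen U) (hne : U.Nonempty) {ε : ℝ} (hε : 0 < ε) :
    ∃ Z : Finset UnitAddCircle, (∀ z ∈ Z, f z ∈ Z) ∧ ∀ᶠ f' : ExpandingCircleMap d in 𝓝 f,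
      ∀ μ : Measure UnitAddCircle, IsProbabilityMeasure μ → MeasurePreserving f' μ μ →
        ∃ z ∈ Z, z ∈ U ∧ ∃ m T : ℕ, f^[m + (T + 1)] z = f^[m] z ∧
          ∀ φ : UnitAddCircle → ℝ, LipschitzWith 1 φ →
            |∫ x, φ x ∂μ - (∑ i ∈ Finset.range (T + 1), φ (f^[m + i] z)) / ((T : ℝ) + 1)| ≤ ε := by
  classical
  have hε4 : 0 < ε / 4 := by positivity
  obtain ⟨C, hC, hspec⟩ := f.exists_periodic_specification
  -- The error `ε` is split in four: replacing `f'` by `f`, oscillation at scale `δ`, sampling, and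
  -- shadowing. The block length `n` makes the shadowing cost `C` per block small per unit of time;
  -- `δ`, `S` and `K` are then chosen in this order.
  obtain ⟨n, hn⟩ := exists_nat_gt (C / (ε / 4))
  have hn' : (0 : ℝ) < n := (by positivity : 0 ≤ C / (ε / 4)).trans_lt hn
  have hn0 : 0 < n := by exact_mod_cast hn'
  have hCn : C / n ≤ ε / 4 := by
    rw [div_lt_iff₀ hε4] at hn
    rw [div_le_iff₀ hn']
    linarith
  obtain ⟨δ, hδ, hequi⟩ := f.exists_equicontinuous_iterate n hε4
  obtain ⟨S, hS⟩ := exists_finset_sample (X := UnitAddCircle) hδ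
  obtain ⟨K, hK⟩ := exists_nat_gt (2 * S.card * 1 / (ε / 4))
  have hK' : (0 : ℝ) < K := (by positivity : 0 ≤ 2 * S.card * 1 / (ε / 4)).trans_lt hK
  have hK0 : 0 < K := by exact_mod_cast hK'
  have hSK : 2 * S.card * 1 / (K : ℝ) ≤ ε / 4 := by
    rw [div_lt_iff₀ hε4] at hK
    rw [div_le_iff₀ hK']
    linarith
  obtain ⟨T, hT⟩ := Nat.exists_eq_add_one_of_ne_zero (Nat.mul_pos hK0 hn0).ne'
  -- There are finitely many samples `c`, and each yields one periodic point `p c` with a preimage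
  -- `y c` in `U`. Hence `Z` is finite and chosen before `f'` and `μ`.
  let ext : (Fin K → S) → ℕ → UnitAddCircle := fun c j => if h : j < K then c ⟨j, h⟩ else 0
  choose p hp hpd using fun c : Fin K → S => hspec K n (ext c) hK0 hn0
  choose y hyU m hym using fun c => f.exists_mem_iterate_eq hU hne (p c)
  have hper : ∀ c, f^[m c + (T + 1)] (y c) = f^[m c] (y c) := by
    intro c
    rw [add_comm, Function.iterate_add_apply, hym, ← hT, hp]
  refine ⟨Finset.univ.biUnion fun c => (Finset.range (m c + (T + 1))).image fun i => f^[i] (y c),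
    ?_, ?_⟩
  · intro z hz
    simp only [Finset.mem_biUnion, Finset.mem_univ, true_and, Finset.mem_image,
      Finset.mem_range] at hz ⊢
    obtain ⟨c, i, hi, rfl⟩ := hz
    rw [← Function.iterate_succ_apply' f i (y c)]
    rcases Nat.lt_or_ge (i + 1) (m c + (T + 1)) with h | h
    · exact ⟨c, i + 1, h, rfl⟩
    · have : i + 1 = m c + (T + 1) := by omega
      exact ⟨c, m c, by omega, by rw [Nat.succ_eq_add_one, this, hper]⟩
  · filter_upwards [f.eventually_dist_iterate_le n hε4] with f' hf' μ hμ hinv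
    obtain ⟨c, hc⟩ := hS μ K hK0
    refine ⟨y c, ?_, hyU c, m c, T, hper c, ?_⟩
    · simp only [Finset.mem_biUnion, Finset.mem_univ, true_and, Finset.mem_image, Finset.mem_range]
      exact ⟨c, 0, by omega, rfl⟩
    have horb : ∀ i, f^[m c + i] (y c) = f^[i] (p c) := by
      intro i
      rw [add_comm, Function.iterate_add_apply, hym]
    have hTcast : (T : ℝ) + 1 = K * n := by exact_mod_cast hT.symm
    -- Normalizing by `φ 0 = 0` bounds a 1-Lipschitz function by `1`, the bound used in the choice
    -- of `K`. Additive constants cancel in the general case.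
    have key : ∀ φ : UnitAddCircle → ℝ, LipschitzWith 1 φ → φ 0 = 0 →
        |∫ x, φ x ∂μ - (∑ i ∈ Finset.range (T + 1), φ (f^[m c + i] (y c))) / ((T : ℝ) + 1)|
          ≤ ε := by
      intro φ hφ hφ0
      set ψ : UnitAddCircle → ℝ := fun x => (∑ i ∈ Finset.range n, φ (f^[i] x)) / n with hψ
      have hψc : Continuous ψ := (continuous_finsetSum _ fun i _ =>
        hφ.continuous.comp (f.continuous_iterate_apply i)).div_const _
      have hb : ∀ x, |φ x| ≤ 1 := by
        intro x
        have h1 := hφ.abs_sub_le_dist x 0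
        rw [hφ0, sub_zero, dist_zero_right] at h1
        have h2 := AddCircle.norm_le_half_period (1 : ℝ) (x := x) one_ne_zero
        norm_num at h2
        linarith
      have h1 := abs_integral_sub_integral_average_le hn0 hf' hinv hφ
      have hψe : ∀ x y, dist x y < δ → |ψ x - ψ y| ≤ ε / 4 := fun x y hxy =>
        abs_average_sub_average_le hn0 fun i hi =>
          (hφ.abs_sub_le_dist _ _).trans (hequi x y hxy i hi)
      have hψb : ∀ x, |ψ x| ≤ 1 := by
        intro x
        have h := abs_average_sub_average_le (e := 1) (a := fun i => φ (f^[i] x)) (b := fun _ => 0)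
          hn0 fun i _ => (by simpa only [sub_zero] using hb (f^[i] x))
        simpa only [Finset.sum_const_zero, zero_div, sub_zero] using h
      have h2 := hc ψ hψc (ε / 4) 1 hψe hψb
      have h3 : |(∑ j, ψ (c j)) / K -
          (∑ i ∈ Finset.range (T + 1), φ (f^[m c + i] (y c))) / ((T : ℝ) + 1)| ≤ C / n := by
        have e1 : ∑ j, ψ (c j) =
            (∑ j ∈ Finset.range K, ∑ i ∈ Finset.range n, φ (f^[i] (ext c j))) / n := by
          rw [Finset.sum_range, Finset.sum_div]
          refine Finset.sum_congr rfl fun j _ => ?_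
          simp [hψ, ext]
        have e2 : ∑ i ∈ Finset.range (T + 1), φ (f^[m c + i] (y c)) =
            ∑ j ∈ Finset.range K, ∑ i ∈ Finset.range n, φ (f^[j * n + i] (p c)) := by
          simp only [horb]
          rw [← hT, Finset.sum_range_mul_eq]
        rw [e1, e2, hTcast, div_div, mul_comm (n : ℝ), ← sub_div, abs_div,
          abs_of_pos (mul_pos hK' hn'), div_le_div_iff₀ (mul_pos hK' hn') hn']
        have h4 : |∑ j ∈ Finset.range K, ∑ i ∈ Finset.range n, φ (f^[i] (ext c j)) -
            ∑ j ∈ Finset.range K, ∑ i ∈ Finset.range n, φ (f^[j * n + i] (p c))| ≤ K * C := by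
          refine le_trans ?_ (hpd c)
          rw [← Finset.sum_sub_distrib]
          refine (Finset.abs_sum_le_sum_abs _ _).trans (Finset.sum_le_sum fun j _ => ?_)
          rw [← Finset.sum_sub_distrib]
          refine (Finset.abs_sum_le_sum_abs _ _).trans (Finset.sum_le_sum fun i _ => ?_)
          rw [dist_comm]
          exact hφ.abs_sub_le_dist _ _
        calc _ ≤ (K * C) * n := mul_le_mul_of_nonneg_right h4 hn'.le
          _ = _ := by ring
      rw [abs_le] at h1 h2 h3 ⊢
      constructor <;> linarith
    intro φ hφ
    have h := key (fun x => φ x - φ 0)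
      (LipschitzWith.of_dist_le_mul fun x y => by
        simpa [Real.dist_eq] using hφ.abs_sub_le_dist x y) (sub_self _)
    have hT0 : (T : ℝ) + 1 ≠ 0 := by positivity
    rw [integral_sub hφ.continuous.integrable_of_compactSpace (integrable_const _),
      Finset.sum_sub_distrib] at h
    simp only [integral_const, probReal_univ, one_smul, Finset.sum_const, Finset.card_range,
      nsmul_eq_mul] at h
    push_cast at h
    rw [sub_div, mul_div_cancel_left₀ _ hT0, sub_sub_sub_cancel_right] at h
    exact h

end ExpandingCircleMap

/-! ### Lipschitz test functions and the dynamics of discretizations. -/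

/-- Uniform convergence of the integrals of `1`-Lipschitz functions implies weak convergence. -/
theorem tendsto_of_abs_integral_sub_le {X : Type*} [PseudoMetricSpace X] [MeasurableSpace X]
    [OpensMeasurableSpace X] {μ : ProbabilityMeasure X} {ν : ℕ → ProbabilityMeasure X} {e : ℕ → ℝ}
    (he : Tendsto e atTop (𝓝 0))
    (h : ∀ k, ∀ φ : X → ℝ, LipschitzWith 1 φ →
      |∫ x, φ x ∂(μ : Measure X) - ∫ x, φ x ∂(ν k : Measure X)| ≤ e k) :
    Tendsto ν atTop (𝓝 μ) := by
  rw [tendsto_iff_forall_lipschitz_integral_tendsto]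
  rintro φ - ⟨L, hL⟩
  have hL1 : (0 : ℝ) < (L : ℝ) + 1 := by positivity
  have hφ : LipschitzWith 1 fun x => φ x / ((L : ℝ) + 1) := by
    refine LipschitzWith.of_dist_le_mul fun x y => ?_
    have h1 := hL.dist_le_mul x y
    rw [Real.dist_eq] at h1 ⊢
    rw [← sub_div, abs_div, abs_of_pos hL1, div_le_iff₀ hL1, NNReal.coe_one, one_mul]
    nlinarith [dist_nonneg (x := x) (y := y)]
  rw [tendsto_iff_dist_tendsto_zero]
  refine squeeze_zero (g := fun k => ((L : ℝ) + 1) * e k) (fun _ => dist_nonneg) (fun k => ?_)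
    (by simpa using he.const_mul ((L : ℝ) + 1))
  have h1 := h k _ hφ
  rw [integral_div, integral_div, ← sub_div, abs_div, abs_of_pos hL1, div_le_iff₀' hL1] at h1
  rw [dist_comm, Real.dist_eq]
  exact h1

/-- At each step `f` lands less than half a grid step from the projection of the next `f₀`-iterate,
so rounding returns exactly that point. -/
theorem discretization_iterate_eq {f f₀ : UnitAddCircle → UnitAddCircle} {N : ℕ+}
    {P : UnitAddCircle → circleGrid N} (hP : IsNearestPointProjection N P)
    {Z : Finset UnitAddCircle} (hZ : ∀ z ∈ Z, f₀ z ∈ Z)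
    (h : ∀ z ∈ Z, dist (f (P z)) (P (f₀ z)) < 1 / (2 * (N : ℕ))) {z : UnitAddCircle}
    (hz : z ∈ Z) (i : ℕ) : (discretization f P)^[i] (P z) = P (f₀^[i] z) := by
  have hmem : ∀ i, f₀^[i] z ∈ Z := by
    intro i
    induction i with
    | zero => exact hz
    | succ i ih => rw [Function.iterate_succ_apply']; exact hZ _ ih
  induction i with
  | zero => rfl
  | succ i ih =>
    rw [Function.iterate_succ_apply', Function.iterate_succ_apply', ih]
    exact Subtype.ext (hP.eq_of_dist_lt (P _).2 (h _ (hmem i)))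

namespace ExpandingCircleMap

variable {d : ℤ}

/-- If the discretization follows, on the projection of a finite set, the dynamics of `f₀` on that
set, then it realises the periodic measures of `f₀` carried by the set. -/
theorem eventually_exists_tendsto_discreteBirkhoffAverage
    {f f₀ : UnitAddCircle → UnitAddCircle} {N : ℕ+}
    {P : UnitAddCircle → circleGrid N} (hP : IsNearestPointProjection N P)
    {Z : Finset UnitAddCircle} (hZ : ∀ z ∈ Z, f₀ z ∈ Z)
    (h : ∀ z ∈ Z, dist (f (P z)) (P (f₀ z)) < 1 / (2 * (N : ℕ))) {z : UnitAddCircle}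
    (hz : z ∈ Z) {m T : ℕ} (hper : f₀^[m + (T + 1)] z = f₀^[m] z) :
    ∀ᶠ x in 𝓝 (P z : UnitAddCircle), ∃ ν : ProbabilityMeasure UnitAddCircle,
      Tendsto (discreteBirkhoffAverage f P x) atTop (𝓝 ν) ∧
      ∀ φ : UnitAddCircle → ℝ, LipschitzWith 1 φ →
        |(∑ i ∈ Finset.range (T + 1), φ (f₀^[m + i] z)) / ((T : ℝ) + 1) -
          ∫ x, φ x ∂(ν : Measure UnitAddCircle)| ≤ 1 / (N : ℕ) := by
  have hN : (0 : ℝ) < 1 / (2 * (N : ℕ)) := by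
    have : (0 : ℝ) < (N : ℕ) := by exact_mod_cast N.pos
    positivity
  -- Every point within half a grid step of a grid point is projected to it, so the conclusion holds
  -- on a whole ball.
  filter_upwards [Metric.ball_mem_nhds _ hN] with x hx
  have hx' : P x = P z := Subtype.ext (hP.eq_of_dist_lt (P z).2 hx)
  have hu : discreteBirkhoffAverage f P x =
      averageDirac fun i => (P (f₀^[i] z) : UnitAddCircle) := by
    unfold discreteBirkhoffAverage
    rw [hx']
    simp only [discretization_iterate_eq hP hZ h hz]
  refine ⟨averageDirac (fun i => (P (f₀^[m + i] z) : UnitAddCircle)) T, ?_, fun φ hφ => ?_⟩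
  · rw [hu]
    refine tendsto_averageDirac _ m T fun i => ?_
    have e : m + i + (T + 1) = i + (m + (T + 1)) := by ring
    rw [e, Function.iterate_add_apply f₀ i, hper, ← Function.iterate_add_apply, add_comm i m]
  · rw [integral_averageDirac]
    have h1 := abs_average_sub_average_le (n := T + 1) (Nat.succ_pos T)
      (a := fun i => φ (f₀^[m + i] z)) (b := fun i => φ (P (f₀^[m + i] z)))
      fun i _ => (hφ.abs_sub_le_dist _ _).trans (hP.dist_le _)
    push_cast at h1
    exact h1

/-! ### The Baire category arguments. -/

/-- The measure is quantified inside the residual set: there are uncountably many invariant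
measures, so a single open condition on `f` has to serve them all. The finite set `Z`, uniform in
`μ`, makes this possible. -/
theorem eventually_residual_exists_approximation {P : (N : ℕ+) → UnitAddCircle → circleGrid N}
    (hP : ∀ N : ℕ+, IsNearestPointProjection N (P N)) {U : Set UnitAddCircle} (hU : IsOpen U)
    (hne : U.Nonempty) {ε : ℝ} (hε : 0 < ε) (n₀ : ℕ) :
    ∀ᶠ f : ExpandingCircleMap d in residual (ExpandingCircleMap d),
      ∀ μ : Measure UnitAddCircle, IsProbabilityMeasure μ → MeasurePreserving f μ μ →
        ∃ n ≥ n₀, ∃ y ∈ U, ∀ᶠ x in 𝓝 y, ∃ ν : ProbabilityMeasure UnitAddCircle,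
          Tendsto (discreteBirkhoffAverage f (P n.succPNat) x) atTop (𝓝 ν) ∧
          ∀ φ : UnitAddCircle → ℝ, LipschitzWith 1 φ →
            |∫ x, φ x ∂μ - ∫ x, φ x ∂(ν : Measure UnitAddCircle)| ≤ ε := by
  set G : Set (ExpandingCircleMap d) := {f | ∀ μ : Measure UnitAddCircle,
    IsProbabilityMeasure μ → MeasurePreserving f μ μ →
        ∃ n ≥ n₀, ∃ y ∈ U, ∀ᶠ x in 𝓝 y, ∃ ν : ProbabilityMeasure UnitAddCircle,
          Tendsto (discreteBirkhoffAverage f (P n.succPNat) x) atTop (𝓝 ν) ∧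
          ∀ φ : UnitAddCircle → ℝ, LipschitzWith 1 φ →
            |∫ x, φ x ∂μ - ∫ x, φ x ∂(ν : Measure UnitAddCircle)| ≤ ε} with hG
  suffices hd : Dense (interior G) from
    mem_of_superset (residual_of_dense_open isOpen_interior hd) interior_subset
  intro f₀
  rw [mem_closure_iff_nhds]
  intro V hV
  obtain ⟨Z, hZ, hO⟩ := f₀.exists_finset_approximating hU hne (half_pos hε)
  have hUZ : ∀ᶠ n : ℕ in atTop, ∀ z ∈ Z, z ∈ U → (P n.succPNat z : UnitAddCircle) ∈ U := by
    rw [Filter.eventually_all_finset]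
    intro z _
    by_cases hz : z ∈ U
    · filter_upwards [(tendsto_projection hP z).eventually (hU.mem_nhds hz)] with n hn _
      exact hn
    · simp [hz]
  have hsmall : ∀ᶠ n : ℕ in atTop, 1 / ((n : ℝ) + 1) < ε / 2 :=
    (tendsto_one_div_add_atTop_nhds_zero_nat (𝕜 := ℝ)).eventually_lt_const (half_pos hε)
  -- The approximation by `Z` is needed for all maps near `f₁`, not only for `f₁`; hence
  -- `hO.eventually_nhds`.
  obtain ⟨n, ⟨f₁, ⟨hf₁V, hf₁O⟩, hf₁⟩, hnU, hnε, hn⟩ :=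
    ((f₀.eventually_exists_map_projection_eq hP Z (inter_mem hV hO.eventually_nhds)).and
      (hUZ.and (hsmall.and (eventually_ge_atTop n₀)))).exists
  refine ⟨f₁, hf₁V, mem_interior_iff_mem_nhds.2 ?_⟩
  have hN : (0 : ℝ) < 1 / (2 * (n.succPNat : ℕ)) := by
    simp only [Nat.succPNat_coe, Nat.succ_eq_add_one]
    positivity
  -- At `f₁` these distances vanish, so being below half a grid step is an open condition around
  -- `f₁`.
  have hclose : ∀ᶠ f : ExpandingCircleMap d in 𝓝 f₁, ∀ z ∈ Z,
      dist (f (P n.succPNat z)) (P n.succPNat (f₀ z)) < 1 / (2 * (n.succPNat : ℕ)) := by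
    rw [Filter.eventually_all_finset]
    intro z hz
    have hcont : Continuous fun f : ExpandingCircleMap d => f (P n.succPNat z : UnitAddCircle) :=
      (continuous_eval_const (P n.succPNat z : UnitAddCircle)).comp continuous_toMap
    have := Metric.tendsto_nhds.1 (hcont.tendsto f₁) _ hN
    rwa [hf₁ z hz] at this
  filter_upwards [hclose, (show ∀ᶠ f in 𝓝 f₁, _ from hf₁O)] with f hfc hfO μ hμ hinv
  obtain ⟨z, hzZ, hzU, m, T, hper, hφ⟩ := hfO μ hμ hinv
  refine ⟨n, hn, P n.succPNat z, hnU z hzZ hzU, ?_⟩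
  filter_upwards [eventually_exists_tendsto_discreteBirkhoffAverage (hP n.succPNat) hZ hfc hzZ
    hper] with x hx
  obtain ⟨ν, hν, hνφ⟩ := hx
  refine ⟨ν, hν, fun φ hL => ?_⟩
  have h1 := hφ φ hL
  have h2 := hνφ φ hL
  simp only [Nat.succPNat_coe, Nat.succ_eq_add_one, Nat.cast_add, Nat.cast_one] at h2
  calc _ ≤ _ := abs_sub_le _ _ _
    _ ≤ ε / 2 + ε / 2 := add_le_add h1 (h2.trans hnε.le)
    _ = ε := add_halves ε

end ExpandingCircleMap

theorem mainTheorem4 (d : ℤ)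
    (P : (N : ℕ+) → UnitAddCircle → circleGrid N)
    (hP : ∀ N : ℕ+, IsNearestPointProjection N (P N)) :
    ∀ᶠ f : ExpandingCircleMap d in residual (ExpandingCircleMap d),
      ∀ μ : ProbabilityMeasure UnitAddCircle,
        MeasurePreserving f (μ : Measure UnitAddCircle) (μ : Measure UnitAddCircle) →
        ∀ᶠ x : UnitAddCircle in residual UnitAddCircle,
          ∃ N : ℕ → ℕ+, StrictMono N ∧
            (∀ k : ℕ, Tendsto (discreteBirkhoffAverage f (P (N k)) x) atTop
              (𝓝 (discreteLimitMeasure f (P (N k)) x))) ∧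
            Tendsto (fun k : ℕ => discreteLimitMeasure f (P (N k)) x) atTop (𝓝 μ) := by
  have hgen : ∀ᶠ f : ExpandingCircleMap d in residual (ExpandingCircleMap d),
      ∀ U ∈ TopologicalSpace.countableBasis UnitAddCircle, ∀ k n₀ : ℕ,
      ∀ μ : Measure UnitAddCircle, IsProbabilityMeasure μ → MeasurePreserving f μ μ →
        ∃ n ≥ n₀, ∃ y ∈ U, ∀ᶠ x in 𝓝 y, ∃ ν : ProbabilityMeasure UnitAddCircle,
          Tendsto (discreteBirkhoffAverage f (P n.succPNat) x) atTop (𝓝 ν) ∧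
          ∀ φ : UnitAddCircle → ℝ, LipschitzWith 1 φ →
            |∫ x, φ x ∂μ - ∫ x, φ x ∂(ν : Measure UnitAddCircle)| ≤ 1 / ((k : ℝ) + 1) := by
    rw [eventually_countable_ball (TopologicalSpace.countable_countableBasis _)]
    intro U hU
    rw [eventually_countable_forall]
    intro k
    rw [eventually_countable_forall]
    intro n₀
    exact ExpandingCircleMap.eventually_residual_exists_approximation hP
      (TopologicalSpace.isOpen_of_mem_countableBasis hU)
      (TopologicalSpace.nonempty_of_mem_countableBasis hU) (by positivity) n₀
  filter_upwards [hgen] with f hf μ hμ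
  have hx : ∀ᶠ x : UnitAddCircle in residual UnitAddCircle, ∀ k n₀ : ℕ,
      ∃ n ≥ n₀, ∃ ν : ProbabilityMeasure UnitAddCircle,
        Tendsto (discreteBirkhoffAverage f (P n.succPNat) x) atTop (𝓝 ν) ∧
        ∀ φ : UnitAddCircle → ℝ, LipschitzWith 1 φ →
          |∫ x, φ x ∂(μ : Measure UnitAddCircle) - ∫ x, φ x ∂(ν : Measure UnitAddCircle)| ≤
            1 / ((k : ℝ) + 1) := by
    rw [eventually_countable_forall]
    intro k
    rw [eventually_countable_forall]
    intro n₀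
    -- Every basic open set contains a point near which the property holds, so the interior of the
    -- good set is dense.
    refine mem_of_superset (residual_of_dense_open isOpen_interior ?_) interior_subset
    rw [(TopologicalSpace.isBasis_countableBasis UnitAddCircle).dense_iff]
    intro U hU _
    obtain ⟨n, hn, y, hy, h⟩ := hf U hU k n₀ μ inferInstance hμ
    exact ⟨y, hy, mem_interior_iff_mem_nhds.2 (h.mono fun x hx => ⟨n, hn, hx⟩)⟩
  filter_upwards [hx] with x hx
  -- Precision `1 / (k + 1)` is attained at arbitrarily large ranks, so the ranks can be chosen
  -- strictly increasing in `k`.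
  obtain ⟨ψ, hψ, hψx⟩ := extraction_forall_of_frequently fun k =>
    frequently_atTop.2 fun n₀ => hx k n₀
  choose ν hν hνφ using hψx
  have hlim : ∀ k, discreteLimitMeasure f (P (ψ k).succPNat) x = ν k := fun k =>
    (hν k).limUnder_eq
  refine ⟨fun k => (ψ k).succPNat, fun a b hab => Nat.succPNat_lt_succPNat.2 (hψ hab),
    fun k => ?_, ?_⟩
  · rw [hlim]
    exact hν k
  · simp only [hlim]
    exact tendsto_of_abs_integral_sub_le (tendsto_one_div_add_atTop_nhds_zero_nat (𝕜 := ℝ)) hνφ
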